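/- Let $m \ge 0$ be an integer and $n = 4m+1$. Let $\mu_{\mathbb{Z}^n}$ be the randomly shifted standard lattice in $\mathbb{R}^n$, that is, the law of the random measure $p = \sum_{k \in \mathbb{Z}^n} \delta_{x+k}$ on $\mathbb{R}^n$, where $x$ is uniformly distributed on $[0,1)^n \cong \mathbb{R}^n/\mathbb{Z}^n$. For $R > 0$ let $B_R \subset \mathbb{R}^n$ be the Euclidean ball of radius $R$ centred at the origin, let $$\mathrm{NV}_{\mu_{\mathbb{Z}^n}}(R) = \mathrm{Var}_{\mu_{\mathbb{Z}^n}}\big(p(B_R)\big)$$ be the number variance, and let $\mathrm{Vol}_{n-1}$ denote $(n-1)$-dimensional surface measure. Then $$\liminf_{R \to +\infty} \frac{\mathrm{NV}_{\mu_{\mathbb{Z}^n}}(R)}{\mathrm{Vol}_{n-1}(\partial B_R)} = 0 .$$ In particular (the case $m = 1$), for $\mathbb{Z}^5$ in $\mathbb{R}^5$, $\liminf_{R \to +\infty} \mathrm{NV}_{\mu_{\mathbb{Z}^5}}(R)/\mathrm{Vol}_4(\partial B_R) = 0$. -/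

import Mathlib

open MeasureTheory Filter

/-- The cone of positive locally finite Borel measures on `X`. It carries the σ-algebra inherited
from `Measure X`, i.e. the one generated by the evaluations `p ↦ p B` with `B` Borel. On a proper
metric space it is also the one generated by the linear statistics `p ↦ ∫ f dp` of bounded
measurable functions `f` with bounded support, because every Borel set is an increasing union of
bounded Borel sets. -/
abbrev LocFinMeasure (X : Type*) [TopologicalSpace X] [MeasurableSpace X] : Type _ :=
  {p : Measure X // IsLocallyFiniteMeasure p}

/-- The linear statistic of the indicator function of a set: `p ↦ p B`. -/
noncomputable def countStatistic {X : Type*} [TopologicalSpace X] [MeasurableSpace X] (B : Set X)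
    (p : LocFinMeasure X) : ℝ :=
  p.1.real B

/-- The number variance of a random measure on `ℝⁿ` (given by its law `μ`): the variance of the
mass `p (B_R)` of the centred ball of radius `R`. It takes values in `[0, ∞]`, so that it is
infinite, and not a default value, when the mass is not square-integrable. -/
noncomputable def numberVariance {n : ℕ} (μ : Measure (LocFinMeasure (EuclideanSpace ℝ (Fin n))))
    (R : ℝ) : ENNReal :=
  ProbabilityTheory.evariance
    (countStatistic (Metric.ball (0 : EuclideanSpace ℝ (Fin n)) R)) μ

/-- The point of `ℝⁿ` with the integer coordinates `k`. -/
noncomputable def intPoint {n : ℕ} (k : Fin n → ℤ) : EuclideanSpace ℝ (Fin n) :=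
  WithLp.toLp 2 (fun i => (k i : ℝ))

/-- The counting measure `∑_{k ∈ ℤⁿ} δ_{x + k}` of the shifted lattice `x + ℤⁿ`, as a measure. -/
noncomputable def latticeCount {n : ℕ} (x : EuclideanSpace ℝ (Fin n)) :
    Measure (EuclideanSpace ℝ (Fin n)) :=
  Measure.sum (fun k : Fin n → ℤ => Measure.dirac (x + intPoint k))

theorem latticeCount_isLocallyFinite {n : ℕ} (x : EuclideanSpace ℝ (Fin n)) :
    IsLocallyFiniteMeasure (latticeCount x) := by
  refine ⟨fun y => ⟨Metric.ball y (1 / 2), Metric.ball_mem_nhds y (by norm_num), ?_⟩⟩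
  have hsub : {k : Fin n → ℤ | x + intPoint k ∈ Metric.ball y (1 / 2)}.Subsingleton := by
    intro k hk l hl
    funext i
    have coord : ∀ k : Fin n → ℤ, x + intPoint k ∈ Metric.ball y (1 / 2) →
        |x i + (k i : ℝ) - y i| < 1 / 2 := by
      intro k hk
      rw [Metric.mem_ball, dist_eq_norm] at hk
      refine lt_of_le_of_lt ?_ hk
      simpa [intPoint] using PiLp.norm_apply_le (x + intPoint k - y) i
    have h1 := abs_lt.1 (coord k hk)
    have h2 := abs_lt.1 (coord l hl)
    have h3 : ((k i - l i : ℤ) : ℝ) < 1 := by push_cast; linarith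
    have h4 : (-1 : ℝ) < ((k i - l i : ℤ) : ℝ) := by push_cast; linarith
    have h5 : k i - l i < 1 := by exact_mod_cast h3
    have h6 : -1 < k i - l i := by exact_mod_cast h4
    omega
  rw [latticeCount, Measure.sum_apply _ Metric.isOpen_ball.measurableSet]
  rw [tsum_eq_sum (s := hsub.finite.toFinset)]
  · refine ENNReal.sum_lt_top.2 fun k _ => measure_lt_top _ _
  · intro k hk
    have hk' : x + intPoint k ∉ Metric.ball y (1 / 2) := by simpa using hk
    rw [Measure.dirac_apply' _ Metric.isOpen_ball.measurableSet, Set.indicator_of_notMem hk']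

/-- The shifted lattice `x + ℤⁿ`, as a locally finite measure with unit masses. -/
noncomputable def shiftedLattice {n : ℕ} (x : EuclideanSpace ℝ (Fin n)) :
    LocFinMeasure (EuclideanSpace ℝ (Fin n)) :=
  ⟨latticeCount x, latticeCount_isLocallyFinite x⟩

theorem measurable_shiftedLattice {n : ℕ} :
    Measurable (shiftedLattice : EuclideanSpace ℝ (Fin n) → _) := by
  refine Measurable.subtype_mk (Measure.measurable_of_measurable_coe _ fun s hs => ?_)
  simp only [latticeCount, Measure.sum_apply _ hs, Measure.dirac_apply' _ hs]
  refine Measurable.tsum fun k => ?_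
  exact (measurable_one.indicator hs).comp (measurable_id.add_const _)

/-- The half-open unit cube `[0, 1)ⁿ`, a fundamental domain of `ℤⁿ` in `ℝⁿ`. -/
def unitCube (n : ℕ) : Set (EuclideanSpace ℝ (Fin n)) :=
  {x | ∀ i, x i ∈ Set.Ico (0 : ℝ) 1}

/-- The law of the randomly shifted standard lattice `x + ℤⁿ`, where the shift `x` is uniformly
distributed on `[0, 1)ⁿ`, i.e. on `ℝⁿ / ℤⁿ`. -/
noncomputable def randomLattice (n : ℕ) : Measure (LocFinMeasure (EuclideanSpace ℝ (Fin n))) :=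
  (volume.restrict (unitCube n)).map shiftedLattice

theorem volume_unitCube (n : ℕ) : volume (unitCube n) = 1 := by
  have h : unitCube n = (MeasurableEquiv.toLp 2 (Fin n → ℝ)).symm ⁻¹'
      (Set.univ.pi fun _ => Set.Ico (0 : ℝ) 1) := by
    ext x; simp [unitCube, Set.mem_pi]
  rw [h, (EuclideanSpace.volume_preserving_symm_measurableEquiv_toLp (Fin n)).measure_preimage_equiv,
    Real.volume_pi_Ico]
  simp

instance randomLattice_isProbabilityMeasure (n : ℕ) :
    IsProbabilityMeasure (randomLattice n) := by
  have : IsProbabilityMeasure ((volume : Measure (EuclideanSpace ℝ (Fin n))).restrict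
      (unitCube n)) := ⟨by rw [Measure.restrict_apply_univ, volume_unitCube]⟩
  exact Measure.isProbabilityMeasure_map measurable_shiftedLattice.aemeasurable

/-! The number of points of `x + ℤⁿ` in `B_R` is a `ℤⁿ`-periodic function of `x` whose Fourier
coefficients are the values at integer points of the Fourier transform of `1_{B_R}`. By Parseval,
the number variance is the sum of their squared norms over `k ≠ 0`
(`numberVariance_randomLattice_eq_tsum`).

For `n = 2p + 1`, slicing the ball orthogonally to the frequency reduces the transform to `∫ (1 -
t²)^p e^{ilt} dt` over `[-1, 1]`, with `l = 2πR‖k‖`. The weight vanishes to order `p` at `±1`, so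
integration by parts gives decay `l^{-(p+1)}`. For even `p` the leading term is a multiple of `sin
l`, and the error is smaller by a factor `1/l`. Hence the variance is at most `C R^{2p} ∑ (|sin
(2πR‖k‖)| + 1/R)² ‖k‖^{-(2p+2)}` over `k ≠ 0`.

The weights `‖k‖^{-(2p+2)}` are summable in dimension `2p + 1`. By recurrence in a compact product
of circles (`exists_ultrafilter_tendsto_sin`), all the sines tend to zero simultaneously along
suitable integers `R → ∞`, and dominated convergence sends the series to zero. The sphere has area
at least a constant times `R^{2p}`. Dimension `4m + 1` is the case `p = 2m`. -/

/-! ### Fourier integrals of polynomials on `[-1, 1]` -/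

/-- The Fourier integral over `[-1, 1]` of a polynomial. -/
noncomputable def polyFourier (P : Polynomial ℂ) (l : ℝ) : ℂ :=
  ∫ t in (-1 : ℝ)..1, P.eval (t : ℂ) * Complex.exp (Complex.I * l * t)

theorem continuous_eval_mul_exp (P : Polynomial ℂ) (l : ℝ) :
    Continuous fun t : ℝ => P.eval (t : ℂ) * Complex.exp (Complex.I * l * t) := by
  have := P.continuous
  fun_prop

theorem polyFourier_ibp (P : Polynomial ℂ) (l : ℝ) :
    Complex.I * l * polyFourier P l = P.eval 1 * Complex.exp (Complex.I * l)
      - P.eval (-1) * Complex.exp (-(Complex.I * l)) - polyFourier P.derivative l := by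
  have hd : ∀ t : ℝ, HasDerivAt (fun t : ℝ => P.eval (t : ℂ) * Complex.exp (Complex.I * l * t))
      (P.derivative.eval (t : ℂ) * Complex.exp (Complex.I * l * t)
        + Complex.I * l * (P.eval (t : ℂ) * Complex.exp (Complex.I * l * t))) t := by
    intro t
    have h1 : HasDerivAt (fun t : ℝ => P.eval (t : ℂ)) (P.derivative.eval (t : ℂ)) t :=
      (P.hasDerivAt (t : ℂ)).comp_ofReal
    have h2 : HasDerivAt (fun t : ℝ => Complex.exp (Complex.I * l * t))
        (Complex.exp (Complex.I * l * t) * (Complex.I * l)) t := by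
      have := ((hasDerivAt_id (t : ℂ)).const_mul (Complex.I * l)).cexp.comp_ofReal
      simpa using this
    refine (h1.mul h2).congr_deriv ?_
    ring
  have h := intervalIntegral.integral_eq_sub_of_hasDerivAt (a := -1) (b := 1)
    (fun t _ => hd t) (((continuous_eval_mul_exp P.derivative l).add
      ((continuous_eval_mul_exp P l).const_mul _)).intervalIntegrable _ _)
  rw [intervalIntegral.integral_add ((continuous_eval_mul_exp _ l).intervalIntegrable _ _)
    (((continuous_eval_mul_exp P l).const_mul _).intervalIntegrable _ _),
    intervalIntegral.integral_const_mul] at h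
  simp only [Complex.ofReal_one, Complex.ofReal_neg, mul_one, mul_neg] at h
  rw [polyFourier, polyFourier, ← h]
  ring

theorem exists_norm_polyFourier_le (P : Polynomial ℂ) : ∃ C, 0 ≤ C ∧ ∀ l, ‖polyFourier P l‖ ≤ C := by
  obtain ⟨C, hC⟩ := isCompact_Icc.exists_bound_of_continuousOn (s := Set.Icc (-1 : ℝ) 1)
    (f := fun t : ℝ => P.eval (t : ℂ)) (P.continuous.comp Complex.continuous_ofReal).continuousOn
  have hC0 : 0 ≤ C := (norm_nonneg _).trans (hC 0 (by norm_num))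
  refine ⟨C * 2, by positivity, fun l => ?_⟩
  have := intervalIntegral.norm_integral_le_of_norm_le_const (a := -1) (b := 1) (C := C)
    (f := fun t : ℝ => P.eval (t : ℂ) * Complex.exp (Complex.I * l * t)) (by
      intro t ht
      rw [Set.uIoc_of_le (by norm_num)] at ht
      rw [norm_mul, show Complex.I * l * t = ((l * t : ℝ) : ℂ) * Complex.I by push_cast; ring,
        Complex.norm_exp_ofReal_mul_I, mul_one]
      exact hC t ⟨ht.1.le, ht.2⟩)
  rw [polyFourier]
  refine this.trans (le_of_eq ?_)
  norm_num

theorem exists_norm_polyFourier_mul_le (P : Polynomial ℂ) :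
    ∃ C, 0 ≤ C ∧ ∀ l : ℝ, 0 < l → ‖polyFourier P l‖ ≤ C / l := by
  obtain ⟨C, hC, h⟩ := exists_norm_polyFourier_le P.derivative
  refine ⟨‖P.eval 1‖ + ‖P.eval (-1)‖ + C, by positivity, fun l hl => ?_⟩
  rw [le_div_iff₀ hl]
  have h1 : ‖polyFourier P l‖ * l = ‖Complex.I * l * polyFourier P l‖ := by
    simp [abs_of_pos hl, mul_comm]
  rw [h1, polyFourier_ibp]
  refine (norm_sub_le _ _).trans (add_le_add ((norm_sub_le _ _).trans (add_le_add ?_ ?_)) (h l))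
  · rw [norm_mul, mul_comm Complex.I, Complex.norm_exp_ofReal_mul_I, mul_one]
  · rw [norm_mul, show -(Complex.I * l) = ((-l : ℝ) : ℂ) * Complex.I by push_cast; ring,
      Complex.norm_exp_ofReal_mul_I, mul_one]

/-- Each of the `p` integrations by parts has vanishing boundary terms. -/
theorem polyFourier_of_iterate_derivative_eval_eq_zero (P : Polynomial ℂ) (l : ℝ) (p : ℕ)
    (h1 : ∀ j < p, (Polynomial.derivative^[j] P).eval 1 = 0)
    (h2 : ∀ j < p, (Polynomial.derivative^[j] P).eval (-1) = 0) :
    (Complex.I * l) ^ p * polyFourier P l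
      = (-1) ^ p * polyFourier (Polynomial.derivative^[p] P) l := by
  induction p with
  | zero => simp
  | succ p ih =>
    have h := polyFourier_ibp (Polynomial.derivative^[p] P) l
    rw [h1 p (by omega), h2 p (by omega)] at h
    rw [pow_succ', mul_assoc, ih (fun j hj => h1 j (by omega)) (fun j hj => h2 j (by omega)),
      Function.iterate_succ_apply', mul_left_comm, h]
    ring

/-- Gives the parity of the derivatives of an even polynomial, which relates the boundary values at
`1` and `-1`. -/
theorem iterate_derivative_comp_neg_X (P : Polynomial ℂ) (j : ℕ) :
    Polynomial.derivative^[j] (P.comp (-Polynomial.X))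
      = (-1) ^ j * (Polynomial.derivative^[j] P).comp (-Polynomial.X) := by
  induction j with
  | zero => simp
  | succ j ih =>
    rw [Function.iterate_succ_apply', ih, Function.iterate_succ_apply']
    have : ((-1 : Polynomial ℂ) ^ j) = Polynomial.C ((-1) ^ j) := by simp
    rw [this, Polynomial.derivative_C_mul, Polynomial.derivative_comp, ← this]
    simp [pow_succ]

theorem iterate_derivative_one_sub_sq_eval (p j : ℕ) (hj : j < p) (a : ℂ) (ha : a ^ 2 = 1) :
    (Polynomial.derivative^[j] ((1 - Polynomial.X ^ 2 : Polynomial ℂ) ^ p)).eval a = 0 := by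
  obtain ⟨Q, hQ⟩ := Polynomial.pow_sub_dvd_iterate_derivative_pow
    (1 - Polynomial.X ^ 2 : Polynomial ℂ) p j
  rw [hQ, Polynomial.eval_mul]
  simp [ha, Nat.sub_ne_zero_of_lt hj]

/-- Decay of the Fourier transform of `(1 - t ^ 2) ^ p` on `[-1, 1]` for even `p`, with the leading
term `sin l` kept. -/
theorem exists_norm_polyFourier_one_sub_sq_le (p : ℕ) (hp : Even p) :
    ∃ C, 0 ≤ C ∧ ∀ l : ℝ, 0 < l →
      ‖polyFourier ((1 - Polynomial.X ^ 2) ^ p) l‖ ≤ C * (|Real.sin l| + 1 / l) / l ^ (p + 1) := by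
  set P : Polynomial ℂ := (1 - Polynomial.X ^ 2) ^ p with hP
  set Q := Polynomial.derivative^[p] P with hQ
  obtain ⟨C, hC, h⟩ := exists_norm_polyFourier_mul_le Q.derivative
  refine ⟨2 * ‖Q.eval 1‖ + C, by positivity, fun l hl => ?_⟩
  -- Evenness of `p` enters here: equal boundary values produce `sin l`. For odd `p` they would be
  -- opposite and produce `cos l`, which recurrence to `1` on the circle does not make small.
  have heven : Q.eval (-1) = Q.eval 1 := by
    have h0 : P.comp (-Polynomial.X) = P := by simp [hP]
    have h1 := iterate_derivative_comp_neg_X P p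
    rw [h0, hp.neg_one_pow, one_mul, ← hQ] at h1
    conv_rhs => rw [h1]
    simp
  have h1 := polyFourier_of_iterate_derivative_eval_eq_zero P l p
    (fun j hj => iterate_derivative_one_sub_sq_eval p j hj 1 (by norm_num))
    (fun j hj => iterate_derivative_one_sub_sq_eval p j hj (-1) (by norm_num))
  rw [hp.neg_one_pow, one_mul, ← hQ] at h1
  have h2 := polyFourier_ibp Q l
  rw [← h1, heven] at h2
  have h3 : Q.eval 1 * Complex.exp (Complex.I * l) - Q.eval 1 * Complex.exp (-(Complex.I * l))
      = Q.eval 1 * (2 * Complex.I * (Real.sin l : ℂ)) := by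
    rw [Complex.ofReal_sin, Complex.sin, mul_comm Complex.I (l : ℂ), neg_mul]
    linear_combination (-(Q.eval 1) * (Complex.exp (-((l : ℂ) * Complex.I))
      - Complex.exp ((l : ℂ) * Complex.I))) * Complex.I_sq
  rw [h3] at h2
  have h4 : ‖polyFourier P l‖ * l ^ (p + 1)
      = ‖Complex.I * l * ((Complex.I * l) ^ p * polyFourier P l)‖ := by
    simp only [norm_mul, norm_pow, Complex.norm_I, Complex.norm_real, Real.norm_eq_abs,
      abs_of_pos hl]
    ring
  rw [le_div_iff₀ (by positivity), h4, h2]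
  refine (norm_sub_le _ _).trans ?_
  have h5 := h l hl
  have h6 : ‖Q.eval 1 * (2 * Complex.I * (Real.sin l : ℂ))‖ = 2 * ‖Q.eval 1‖ * |Real.sin l| := by
    simp only [norm_mul, Complex.norm_I, Complex.norm_real, Real.norm_eq_abs, Complex.norm_ofNat]
    ring
  rw [h6]
  have h7 : 0 ≤ C * |Real.sin l| := by positivity
  have h8 : 0 ≤ 2 * ‖Q.eval 1‖ * (1 / l) := by positivity
  calc _ ≤ 2 * ‖Q.eval 1‖ * |Real.sin l| + C / l := by gcongr
    _ ≤ _ := by rw [add_mul, mul_add, mul_add, mul_one_div C]; linarith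

/-! ### Integer points and summability -/

theorem norm_intPoint_ge_one {n : ℕ} {k : Fin n → ℤ} (hk : k ≠ 0) : 1 ≤ ‖intPoint k‖ := by
  obtain ⟨i, hi⟩ := Function.ne_iff.1 hk
  refine le_trans ?_ (PiLp.norm_apply_le (intPoint k) i)
  have : (1 : ℝ) ≤ |(k i : ℝ)| := by exact_mod_cast Int.one_le_abs hi
  simpa [intPoint] using this

theorem intPoint_injective (n : ℕ) :
    Function.Injective (intPoint : (Fin n → ℤ) → EuclideanSpace ℝ (Fin n)) := by
  intro k l h
  funext i
  have := congrArg (fun x : EuclideanSpace ℝ (Fin n) => x i) h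
  simpa [intPoint] using this

theorem intPoint_mem_span (n : ℕ) (k : Fin n → ℤ) : intPoint k ∈
    Submodule.span ℤ (Set.range (EuclideanSpace.basisFun (Fin n) ℝ).toBasis) := by
  rw [Module.Basis.mem_span_iff_repr_mem ℤ]
  intro i
  exact ⟨k i, by simp [intPoint]⟩

theorem finrank_span_basisFun (n : ℕ) : Module.finrank ℤ
    (Submodule.span ℤ (Set.range (EuclideanSpace.basisFun (Fin n) ℝ).toBasis)) = n := by
  rw [ZLattice.rank ℝ, finrank_euclideanSpace_fin]

theorem summable_inv_norm_pow_span_basisFun (n r : ℕ) (hr : n < r) :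
    Summable fun z : Submodule.span ℤ (Set.range (EuclideanSpace.basisFun (Fin n) ℝ).toBasis) =>
      ‖(z : EuclideanSpace ℝ (Fin n))‖⁻¹ ^ r :=
  ZLattice.summable_norm_pow_inv
    (Submodule.span ℤ (Set.range (EuclideanSpace.basisFun (Fin n) ℝ).toBasis)) r
    (by rw [finrank_span_basisFun]; exact hr)

theorem summable_inv_norm_intPoint_pow (n r : ℕ) (hr : n < r) :
    Summable fun k : Fin n → ℤ => ‖intPoint k‖⁻¹ ^ r := by
  have h := summable_inv_norm_pow_span_basisFun n r hr
  have hmem := intPoint_mem_span n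
  generalize Submodule.span ℤ (Set.range (EuclideanSpace.basisFun (Fin n) ℝ).toBasis) = L
    at h hmem
  have hinj : Function.Injective fun k : Fin n → ℤ => (⟨intPoint k, hmem k⟩ : L) := by
    intro k l hkl
    rw [Subtype.mk.injEq] at hkl
    exact intPoint_injective n hkl
  have h2 := Summable.comp_injective h hinj
  simpa only [Function.comp_def] using h2

/-! ### Simultaneous recurrence -/

/-- Simultaneous recurrence: along some ultrafilter of natural numbers tending to infinity, all the
numbers `sin (R * a k)` tend to zero. -/
theorem exists_ultrafilter_tendsto_sin {ι : Type*} (a : ι → ℝ) :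
    ∃ U : Ultrafilter ℕ, (U : Filter ℕ) ≤ atTop ∧
      ∀ k, Tendsto (fun R : ℕ => Real.sin (R * a k)) U (nhds 0) := by
  -- In the compact group `ι → Circle`, the powers of any element cluster at `1`. An ultrafilter
  -- works for every `ι`, with no countability assumption.
  have h := mapClusterPt_one_atTop_pow (fun k => Circle.exp (a k))
  obtain ⟨U, hU, hlim⟩ := mapClusterPt_iff_ultrafilter.1 h
  refine ⟨U, hU, fun k => ?_⟩
  have h1 := (tendsto_pi_nhds.1 hlim) k
  have h2 : Continuous fun z : Circle => (z : ℂ).im := by fun_prop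
  have h3 := (h2.tendsto _).comp h1
  simp only [Pi.one_apply, Circle.coe_one, Complex.one_im] at h3
  refine h3.congr fun R => ?_
  simp only [Function.comp_apply, Pi.pow_apply, Circle.coe_pow, Circle.coe_exp]
  rw [← Complex.exp_nat_mul, ← mul_assoc, ← Complex.ofReal_natCast, ← Complex.ofReal_mul,
    Complex.exp_ofReal_mul_I_im]

/-! ### Lower bound for the area of the sphere -/

theorem euclideanHausdorffMeasure_image_le_of_lipschitzWith_one {X Y : Type*} [EMetricSpace X]
    [MeasurableSpace X] [BorelSpace X] [EMetricSpace Y] [MeasurableSpace Y] [BorelSpace Y]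
    {f : X → Y} (hf : LipschitzWith 1 f) (d : ℕ) (s : Set X) :
    Measure.euclideanHausdorffMeasure d (f '' s) ≤ Measure.euclideanHausdorffMeasure d s := by
  simp only [Measure.euclideanHausdorffMeasure_def, Measure.smul_apply]
  have := hf.hausdorffMeasure_image_le (d := d) (by positivity) s
  gcongr
  simpa using this

/-- The sphere of radius `R` projects onto the ball of radius `R` of one dimension less. -/
theorem volume_ball_le_euclideanHausdorffMeasure_sphere (d : ℕ) (R : ℝ) :
    volume (Metric.ball (0 : EuclideanSpace ℝ (Fin d)) R) ≤
      Measure.euclideanHausdorffMeasure d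
        (Metric.sphere (0 : EuclideanSpace ℝ (Fin (d + 1))) R) := by
  let f : EuclideanSpace ℝ (Fin (d + 1)) → EuclideanSpace ℝ (Fin d) :=
    fun x => WithLp.toLp 2 fun i => x i.succ
  have hf : LipschitzWith 1 f := by
    refine LipschitzWith.of_dist_le_mul fun x y => ?_
    rw [NNReal.coe_one, one_mul, EuclideanSpace.dist_eq, EuclideanSpace.dist_eq]
    refine Real.sqrt_le_sqrt ?_
    rw [Fin.sum_univ_succ]
    exact le_add_of_nonneg_left (by positivity)
  refine le_trans ?_ (euclideanHausdorffMeasure_image_le_of_lipschitzWith_one hf d _)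
  rw [EuclideanSpace.euclideanHausdorffMeasure_eq_volume]
  refine measure_mono fun z hz => ?_
  have hz' : ‖z‖ < R := by simpa using hz
  have hR : 0 ≤ R := (norm_nonneg z).trans hz'.le
  -- The lift of `z` to the hemisphere with nonnegative first coordinate.
  refine ⟨WithLp.toLp 2 (Fin.cons (√(R ^ 2 - ‖z‖ ^ 2)) z.ofLp), ?_, ?_⟩
  · have h0 : 0 ≤ R ^ 2 - ‖z‖ ^ 2 := by nlinarith [norm_nonneg z]
    rw [mem_sphere_zero_iff_norm, EuclideanSpace.norm_eq, Fin.sum_univ_succ]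
    simp only [Fin.cons_zero, Fin.cons_succ]
    rw [Real.norm_eq_abs, sq_abs, Real.sq_sqrt h0, ← EuclideanSpace.norm_sq_eq,
      sub_add_cancel, Real.sqrt_sq hR]
  · ext i
    simp [f]

/-! ### Fourier transform of the ball -/

/-- The volume of the unit ball. -/
noncomputable def unitBallVolume (d : ℕ) : ℝ :=
  volume.real (Metric.ball (0 : EuclideanSpace ℝ (Fin d)) 1)

theorem unitBallVolume_pos (d : ℕ) : 0 < unitBallVolume d :=
  ENNReal.toReal_pos (Metric.measure_ball_pos _ _ one_pos).ne' measure_ball_lt_top.ne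

theorem volume_ball_eq (d : ℕ) {R : ℝ} (hR : 0 < R) :
    volume (Metric.ball (0 : EuclideanSpace ℝ (Fin d)) R)
      = ENNReal.ofReal (R ^ d * unitBallVolume d) := by
  rw [Measure.addHaar_ball_of_pos _ _ hR, finrank_euclideanSpace_fin,
    ENNReal.ofReal_mul (by positivity), unitBallVolume, ofReal_measureReal measure_ball_lt_top.ne]

/-- Splitting off the first coordinate of Euclidean space. -/
noncomputable def splitFirst (d : ℕ) :
    EuclideanSpace ℝ (Fin (d + 1)) ≃ᵐ ℝ × EuclideanSpace ℝ (Fin d) :=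
  ((MeasurableEquiv.toLp 2 (Fin (d + 1) → ℝ)).symm.trans
    (MeasurableEquiv.piFinSuccAbove (fun _ => ℝ) 0)).trans
    (MeasurableEquiv.prodCongr (MeasurableEquiv.refl ℝ) (MeasurableEquiv.toLp 2 (Fin d → ℝ)))

theorem splitFirst_apply (d : ℕ) (x : EuclideanSpace ℝ (Fin (d + 1))) :
    splitFirst d x = (x 0, WithLp.toLp 2 fun i => x i.succ) := rfl

theorem measurePreserving_splitFirst (d : ℕ) :
    MeasurePreserving (splitFirst d) volume (volume.prod volume) := by
  have h1 := EuclideanSpace.volume_preserving_symm_measurableEquiv_toLp (Fin (d + 1))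
  have h2 := volume_preserving_piFinSuccAbove (fun _ : Fin (d + 1) => ℝ) 0
  have h3 := (MeasurePreserving.id (volume : Measure ℝ)).prod
    (EuclideanSpace.volume_preserving_symm_measurableEquiv_toLp (Fin d)).symm
  exact (h3.comp h2).comp h1

/-- By rotation invariance, the linear form `⟪u, ·⟫` can be replaced by the first coordinate. -/
theorem setIntegral_ball_inner (d : ℕ) (u : EuclideanSpace ℝ (Fin (d + 1))) (hu : ‖u‖ = 1)
    (R : ℝ) (φ : ℝ → ℂ) :
    ∫ x in Metric.ball (0 : EuclideanSpace ℝ (Fin (d + 1))) R, φ (inner ℝ u x)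
      = ∫ x in Metric.ball (0 : EuclideanSpace ℝ (Fin (d + 1))) R, φ (x 0) := by
  -- Extend `u` to an orthonormal basis with `b 0 = u`; its coordinate map preserves both the volume
  -- and the ball.
  have hv : Orthonormal ℝ (({0} : Set (Fin (d + 1))).domRestrict fun _ => u) :=
    ⟨fun i => by simpa using hu, fun i j hij => absurd (Subsingleton.elim i j) hij⟩
  obtain ⟨b, hb⟩ := hv.exists_orthonormalBasis_extension_of_card_eq
    (by rw [finrank_euclideanSpace_fin, Fintype.card_fin])
  have h := b.measurePreserving_repr.setIntegral_preimage_emb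
    b.repr.toHomeomorph.measurableEmbedding (fun y => φ (y 0)) (Metric.ball 0 R)
  have hs : b.repr ⁻¹' Metric.ball 0 R = Metric.ball 0 R := by
    ext x; simp
  rw [hs] at h
  rw [← h]
  simp only [OrthonormalBasis.repr_apply_apply, hb 0 rfl]

/-- Fubini: the slice at height `t` is a `d`-dimensional ball of radius `√(1 - t²)`, empty for `|t|
≥ 1`. -/
theorem setIntegral_ball_first (d : ℕ) (φ : ℝ → ℂ) (hφ : Continuous φ) (hb : ∀ t, ‖φ t‖ ≤ 1) :
    ∫ x in Metric.ball (0 : EuclideanSpace ℝ (Fin (d + 1))) 1, φ (x 0)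
      = unitBallVolume d * ∫ t in (-1 : ℝ)..1, ((√(1 - t ^ 2) ^ d : ℝ) : ℂ) * φ t := by
  let S : Set (ℝ × EuclideanSpace ℝ (Fin d)) := {p | p.1 ^ 2 + ‖p.2‖ ^ 2 < 1}
  have hS : MeasurableSet S :=
    (isOpen_lt (by fun_prop) continuous_const).measurableSet
  have hpre : splitFirst d ⁻¹' S = Metric.ball 0 1 := by
    ext x
    rw [Set.mem_preimage, splitFirst_apply, mem_ball_zero_iff, ← sq_lt_one_iff₀ (norm_nonneg x),
      EuclideanSpace.norm_sq_eq, Fin.sum_univ_succ]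
    simp [S, EuclideanSpace.norm_sq_eq]
  have h1 := (measurePreserving_splitFirst d).setIntegral_preimage_emb
    (splitFirst d).measurableEmbedding (fun p => φ p.1) S
  have hvol : (volume.prod volume) S < ⊤ := by
    rw [← (measurePreserving_splitFirst d).measure_preimage hS.nullMeasurableSet, hpre]
    exact measure_ball_lt_top
  have hint : IntegrableOn (fun p : ℝ × EuclideanSpace ℝ (Fin d) => φ p.1) S
      (volume.prod volume) :=
    Measure.integrableOn_of_bounded hvol.ne
      (hφ.comp continuous_fst).aestronglyMeasurable (M := 1) (ae_of_all _ fun p => hb p.1)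
  rw [hpre] at h1
  have h2 : ∀ x, φ ((splitFirst d x).1) = φ (x 0) := fun x => rfl
  simp only [h2] at h1
  rw [h1, ← integral_indicator hS, integral_prod _ ((integrable_indicator_iff hS).2 hint),
    ← intervalIntegral.integral_const_mul, intervalIntegral.integral_of_le (by norm_num),
    integral_Ioc_eq_integral_Ioo, ← integral_indicator measurableSet_Ioo]
  congr 1
  funext t
  by_cases ht : t ∈ Set.Ioo (-1 : ℝ) 1
  · rw [Set.indicator_of_mem ht]
    have hpos : 0 < 1 - t ^ 2 := by nlinarith [ht.1, ht.2]
    have hset : (fun z : EuclideanSpace ℝ (Fin d) => S.indicator (fun p => φ p.1) (t, z))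
        = (Metric.ball 0 √(1 - t ^ 2)).indicator fun _ => φ t := by
      funext z
      simp only [Set.indicator_apply]
      congr 1
      rw [mem_ball_zero_iff, Real.lt_sqrt (norm_nonneg z), eq_iff_iff]
      change t ^ 2 + ‖z‖ ^ 2 < 1 ↔ _
      constructor <;> intro h <;> linarith
    rw [hset, integral_indicator Metric.isOpen_ball.measurableSet, setIntegral_const,
      measureReal_def, volume_ball_eq d (Real.sqrt_pos.2 hpos),
      ENNReal.toReal_ofReal (mul_nonneg (by positivity) (unitBallVolume_pos d).le)]
    rw [Complex.real_smul]
    push_cast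
    ring
  · rw [Set.indicator_of_notMem ht]
    have hset : (fun z : EuclideanSpace ℝ (Fin d) => S.indicator (fun p => φ p.1) (t, z))
        = fun _ => 0 := by
      funext z
      refine Set.indicator_of_notMem (fun h => ht ?_) _
      have h' : t ^ 2 + ‖z‖ ^ 2 < 1 := h
      have h3 : t ^ 2 < 1 := by nlinarith [sq_nonneg ‖z‖]
      exact abs_lt.1 ((sq_lt_one_iff_abs_lt_one t).1 h3)
    rw [hset, integral_zero]

/-- The Fourier transform of the indicator function of the ball of radius `R`. -/
noncomputable def ballFourier (n : ℕ) (R : ℝ) (ξ : EuclideanSpace ℝ (Fin n)) : ℂ :=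
  ∫ x in Metric.ball (0 : EuclideanSpace ℝ (Fin n)) R,
    Complex.exp (Complex.I * ((-(2 * Real.pi * inner ℝ ξ x) : ℝ) : ℂ))

/-- In odd dimension the slice volume is proportional to `√(1 - t²)^(2p) = (1 - t²)^p`, a
polynomial, so no Bessel functions are needed. -/
theorem norm_ballFourier (p : ℕ) {R : ℝ} (hR : 0 < R)
    {ξ : EuclideanSpace ℝ (Fin (2 * p + 1))} (hξ : ξ ≠ 0) :
    ‖ballFourier (2 * p + 1) R ξ‖ = R ^ (2 * p + 1) * (unitBallVolume (2 * p)
      * ‖polyFourier ((1 - Polynomial.X ^ 2) ^ p) (2 * Real.pi * R * ‖ξ‖)‖) := by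
  have hξ' : ‖ξ‖ ≠ 0 := norm_ne_zero_iff.2 hξ
  have h1 := Measure.setIntegral_comp_smul_of_pos
    (volume : Measure (EuclideanSpace ℝ (Fin (2 * p + 1))))
    (fun x => Complex.exp (Complex.I * ((-(2 * Real.pi * inner ℝ ξ x) : ℝ) : ℂ)))
    (Metric.ball 0 1) hR
  rw [smul_unitBall_of_pos hR, finrank_euclideanSpace_fin] at h1
  have h2 : ballFourier (2 * p + 1) R ξ = (R ^ (2 * p + 1) : ℝ) •
      ∫ x in Metric.ball (0 : EuclideanSpace ℝ (Fin (2 * p + 1))) 1,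
        Complex.exp (Complex.I * ((-(2 * Real.pi * inner ℝ ξ (R • x)) : ℝ) : ℂ)) := by
    rw [h1, smul_inv_smul₀ (by positivity), ballFourier]
  let φ : ℝ → ℂ := fun t => Complex.exp (Complex.I * ((2 * Real.pi * R * ‖ξ‖ : ℝ) : ℂ) * t)
  have hφ : ∀ x, Complex.exp (Complex.I * ((-(2 * Real.pi * inner ℝ ξ (R • x)) : ℝ) : ℂ))
      -- The unit vector `-ξ / ‖ξ‖` absorbs the minus sign of the exponent.
      = φ (inner ℝ ((-‖ξ‖⁻¹) • ξ) x) := by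
    intro x
    simp only [φ]
    rw [mul_assoc Complex.I, ← Complex.ofReal_mul, real_inner_smul_left, real_inner_smul_right]
    congr 3
    field_simp
  have h3 : ∀ t : ℝ, (((√(1 - t ^ 2) ^ (2 * p) : ℝ) : ℂ) * φ t) =
      (((√(1 - t ^ 2) ^ 2) ^ p : ℝ) : ℂ) * φ t := fun t => by rw [pow_mul]
  simp only [hφ] at h2
  rw [h2, setIntegral_ball_inner _ _ (by rw [norm_smul, norm_neg, norm_inv, norm_norm, inv_mul_cancel₀ hξ']),
    setIntegral_ball_first _ φ (by fun_prop) (fun t => by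
      simp only [φ]
      rw [mul_assoc Complex.I, ← Complex.ofReal_mul, mul_comm Complex.I, Complex.norm_exp_ofReal_mul_I]),
    norm_smul, norm_mul, Complex.norm_real, Real.norm_of_nonneg (unitBallVolume_pos _).le,
    Real.norm_of_nonneg (by positivity : 0 ≤ R ^ (2 * p + 1)), polyFourier]
  congr 3
  refine intervalIntegral.integral_congr fun t ht => ?_
  rw [Set.uIcc_of_le (by norm_num)] at ht
  have h0 : 0 ≤ 1 - t ^ 2 := by nlinarith [ht.1, ht.2]
  simp only [h3, Real.sq_sqrt h0, φ]
  simp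

/-- Squaring `R^(2p+1) / (R‖ξ‖)^(p+1)` leaves `R^(2p) ‖ξ‖^{-(2p+2)}`: the growth of the surface area
times a weight summable over nonzero integer points. -/
theorem exists_norm_ballFourier_sq_le (p : ℕ) (hp : Even p) :
    ∃ C, 0 ≤ C ∧ ∀ {R : ℝ}, 0 < R → ∀ {ξ : EuclideanSpace ℝ (Fin (2 * p + 1))}, ξ ≠ 0 →
      ‖ballFourier (2 * p + 1) R ξ‖ ^ 2 ≤ C * R ^ (2 * p) *
        ((|Real.sin (R * (2 * Real.pi * ‖ξ‖))| + 1 / (R * ‖ξ‖)) ^ 2 * ‖ξ‖⁻¹ ^ (2 * p + 2)) := by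
  obtain ⟨C, hC, h⟩ := exists_norm_polyFourier_one_sub_sq_le p hp
  refine ⟨(unitBallVolume (2 * p) * C) ^ 2, by positivity, fun {R} hR {ξ} hξ => ?_⟩
  have hξ' : 0 < ‖ξ‖ := norm_pos_iff.2 hξ
  have hω := unitBallVolume_pos (2 * p)
  have hl : R * ‖ξ‖ ≤ 2 * Real.pi * R * ‖ξ‖ := by
    have : 0 < R * ‖ξ‖ := by positivity
    nlinarith [Real.pi_gt_three]
  have h1 := h (2 * Real.pi * R * ‖ξ‖) (by positivity)
  have h2 : ‖polyFourier ((1 - Polynomial.X ^ 2) ^ p) (2 * Real.pi * R * ‖ξ‖)‖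
      ≤ C * (|Real.sin (R * (2 * Real.pi * ‖ξ‖))| + 1 / (R * ‖ξ‖)) / (R * ‖ξ‖) ^ (p + 1) := by
    refine h1.trans ?_
    rw [show R * (2 * Real.pi * ‖ξ‖) = 2 * Real.pi * R * ‖ξ‖ by ring]
    gcongr
  rw [norm_ballFourier p hR hξ]
  calc _ ≤ (R ^ (2 * p + 1) * (unitBallVolume (2 * p) *
        (C * (|Real.sin (R * (2 * Real.pi * ‖ξ‖))| + 1 / (R * ‖ξ‖)) / (R * ‖ξ‖) ^ (p + 1)))) ^ 2 := by
        gcongr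
    _ = _ := by
        generalize |Real.sin (R * (2 * Real.pi * ‖ξ‖))| + 1 / (R * ‖ξ‖) = A
        rw [inv_pow]
        field_simp
        ring

/-! ### Parseval and unfolding on the unit cube -/

theorem measurableSet_unitCube (n : ℕ) : MeasurableSet (unitCube n) := by
  have : unitCube n = ⋂ i, {x : EuclideanSpace ℝ (Fin n) | x i ∈ Set.Ico (0 : ℝ) 1} := by
    ext x; simp [unitCube]
  rw [this]
  refine MeasurableSet.iInter fun i => ?_
  exact measurableSet_Ico.preimage (by fun_prop)

theorem setIntegral_pi_Ioc_eq_unitCube {F : Type*} [NormedAddCommGroup F] [NormedSpace ℝ F] (n : ℕ)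
    (h : EuclideanSpace ℝ (Fin n) → F) :
    ∫ x in {x : Fin n → ℝ | ∀ i, x i ∈ Set.Ioc (0 : ℝ) (0 + 1)}, h (WithLp.toLp 2 x)
      = ∫ x in unitCube n, h x := by
  have h1 : {x : Fin n → ℝ | ∀ i, x i ∈ Set.Ioc (0 : ℝ) (0 + 1)} =ᵐ[volume]
      {x : Fin n → ℝ | ∀ i, x i ∈ Set.Ico (0 : ℝ) 1} := by
    have ha : (Set.univ.pi fun _ : Fin n => Set.Ioc (0 : ℝ) (0 + 1)) =ᵐ[volume]
        Set.univ.pi fun _ : Fin n => Set.Ico (0 : ℝ) (0 + 1) :=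
      Measure.univ_pi_Ioc_ae_eq_Icc.trans Measure.univ_pi_Ico_ae_eq_Icc.symm
    simpa [Set.pi] using ha
  rw [setIntegral_congr_set h1]
  have h2 := (EuclideanSpace.volume_preserving_symm_measurableEquiv_toLp
    (Fin n)).symm.setIntegral_preimage_emb
    (MeasurableEquiv.toLp 2 (Fin n → ℝ)).measurableEmbedding h (unitCube n)
  rw [← h2]
  rfl

/-- The character of `ℝⁿ` with integer frequency `-k`. -/
noncomputable def cubeChar {n : ℕ} (k : Fin n → ℤ) (x : EuclideanSpace ℝ (Fin n)) : ℂ :=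
  Complex.exp (Complex.I * ((-(2 * Real.pi * inner ℝ (intPoint k) x) : ℝ) : ℂ))

theorem norm_cubeChar {n : ℕ} (k : Fin n → ℤ) (x : EuclideanSpace ℝ (Fin n)) :
    ‖cubeChar k x‖ = 1 := by
  rw [cubeChar, mul_comm, Complex.norm_exp_ofReal_mul_I]

theorem continuous_cubeChar {n : ℕ} (k : Fin n → ℤ) : Continuous (cubeChar k) := by
  unfold cubeChar
  fun_prop

theorem cubeChar_add_intPoint {n : ℕ} (k l : Fin n → ℤ) (x : EuclideanSpace ℝ (Fin n)) :
    cubeChar k (x + intPoint l) = cubeChar k x := by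
  have h : inner ℝ (intPoint k) (intPoint l) = ((∑ i, k i * l i : ℤ) : ℝ) := by
    simp [PiLp.inner_apply, intPoint, mul_comm]
  rw [cubeChar, cubeChar, inner_add_right, h, Complex.exp_eq_exp_iff_exists_int]
  refine ⟨-∑ i, k i * l i, ?_⟩
  push_cast
  ring

theorem mFourier_neg_eq_cubeChar {n : ℕ} (k : Fin n → ℤ) (x : Fin n → ℝ) :
    UnitAddTorus.mFourier (-k) (fun i => (x i : UnitAddCircle)) = cubeChar k (WithLp.toLp 2 x) := by
  simp only [UnitAddTorus.mFourier, ContinuousMap.coe_mk, fourier_coe_apply, Pi.neg_apply]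
  rw [← Complex.exp_sum, cubeChar]
  congr 1
  simp only [PiLp.inner_apply, intPoint, RCLike.inner_apply, conj_trivial]
  push_cast
  rw [Finset.mul_sum, ← Finset.sum_neg_distrib, Finset.mul_sum]
  refine Finset.sum_congr rfl fun i _ => ?_
  ring

section

-- Normalised Haar measure makes the characters of `UnitAddTorus` orthonormal.
noncomputable local instance haarUnitAddCircle : MeasureSpace UnitAddCircle := ⟨AddCircle.haarAddCircle⟩

local instance : IsProbabilityMeasure (volume : Measure UnitAddCircle) :=
  inferInstanceAs (IsProbabilityMeasure AddCircle.haarAddCircle)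

/-- Parseval's identity for bounded functions on the unit cube. -/
theorem hasSum_sq_norm_integral_cubeChar {n : ℕ} (g : EuclideanSpace ℝ (Fin n) → ℂ)
    (hg : Measurable g) (C : ℝ) (hC : ∀ x, (∀ i, x i ∈ Set.Icc (0 : ℝ) 1) → ‖g x‖ ≤ C) :
    HasSum (fun k : Fin n → ℤ => ‖∫ x in unitCube n, cubeChar k x * g x‖ ^ 2)
      (∫ x in unitCube n, ‖g x‖ ^ 2) := by
  -- Representatives are taken in `(0, 1]ⁿ`, whereas `unitCube` is `[0, 1)ⁿ`; the bound on `g` is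
  -- therefore assumed on the closed cube.
  let lift : UnitAddTorus (Fin n) → EuclideanSpace ℝ (Fin n) := fun θ =>
    WithLp.toLp 2 fun i => (AddCircle.measurableEquivIoc 1 0 (θ i)).1
  have hlift : Measurable lift := by
    refine (MeasurableEquiv.toLp 2 (Fin n → ℝ)).measurable.comp (measurable_pi_lambda _ fun i => ?_)
    exact measurable_subtype_coe.comp
      ((AddCircle.measurableEquivIoc 1 0).measurable.comp (measurable_pi_apply i))
  have hlift_coe : ∀ x : Fin n → ℝ, (∀ i, x i ∈ Set.Ioc (0 : ℝ) (0 + 1)) →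
      lift (fun i => (x i : UnitAddCircle)) = WithLp.toLp 2 x := by
    intro x hx
    simp only [lift]
    congr 1
    funext i
    exact congrArg Subtype.val ((AddCircle.equivIoc (1 : ℝ) 0).right_inv ⟨x i, hx i⟩)
  have hm : MeasurableSet {x : Fin n → ℝ | ∀ i, x i ∈ Set.Ioc (0 : ℝ) (0 + 1)} :=
    MeasurableSet.univ_pi' fun i => measurableSet_Ioc
  have hmem : MemLp (g ∘ lift) 2 (volume : Measure (UnitAddTorus (Fin n))) := by
    refine MemLp.of_bound (hg.comp hlift).aestronglyMeasurable C (ae_of_all _ fun θ => hC _ ?_)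
    intro i
    have := (AddCircle.measurableEquivIoc 1 0 (θ i)).2
    exact ⟨this.1.le, this.2.trans (zero_add 1).le⟩
  have h := UnitAddTorus.hasSum_sq_mFourierCoeff (hmem.toLp (g ∘ lift))
  have hae := hmem.coeFn_toLp
  have h1 : ∫ θ, ‖hmem.toLp (g ∘ lift) θ‖ ^ 2 = ∫ x in unitCube n, ‖g x‖ ^ 2 := by
    rw [integral_congr_ae (g := fun θ => ‖g (lift θ)‖ ^ 2)
      (by filter_upwards [hae] with θ hθ; rw [hθ]; rfl),
      UnitAddTorus.integral_preimage _ 0, ← setIntegral_pi_Ioc_eq_unitCube]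
    refine setIntegral_congr_fun hm fun x hx => ?_
    simp only [hlift_coe x hx]
  have h2 : ∀ k : Fin n → ℤ, UnitAddTorus.mFourierCoeff (hmem.toLp (g ∘ lift)) k
      = ∫ x in unitCube n, cubeChar k x * g x := by
    intro k
    rw [UnitAddTorus.mFourierCoeff, integral_congr_ae
      (g := fun θ => UnitAddTorus.mFourier (-k) θ • g (lift θ))
      (by filter_upwards [hae] with θ hθ; rw [hθ]; rfl),
      UnitAddTorus.integral_preimage _ 0, ← setIntegral_pi_Ioc_eq_unitCube]
    refine setIntegral_congr_fun hm fun x hx => ?_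
    simp only [hlift_coe x hx, mFourier_neg_eq_cubeChar, smul_eq_mul]
  rw [h1] at h
  simpa only [h2] using h

end

/-- The integer translates of the cube tile the space, with `x` in the tile indexed by its
coordinatewise floors. -/
theorem hasSum_setIntegral_unitCube_add {n : ℕ} {G : Type*} [NormedAddCommGroup G]
    [NormedSpace ℝ G] (F : EuclideanSpace ℝ (Fin n) → G)
    (hF : Integrable F) :
    HasSum (fun l : Fin n → ℤ => ∫ x in unitCube n, F (x + intPoint l)) (∫ x, F x) := by
  let s : (Fin n → ℤ) → Set (EuclideanSpace ℝ (Fin n)) := fun l =>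
    (fun x => x - intPoint l) ⁻¹' unitCube n
  have hs : ∀ l, MeasurableSet (s l) := fun l =>
    (measurableSet_unitCube n).preimage (measurable_id.sub_const _)
  have hfloor : ∀ l x, x ∈ s l → ∀ i, ⌊x i⌋ = l i := by
    intro l x hx i
    have := hx i
    simp only [PiLp.sub_apply, intPoint] at this
    exact Int.floor_eq_iff.2 ⟨by linarith [this.1], by linarith [this.2]⟩
  have hdisj : Pairwise (Function.onFun Disjoint s) := by
    intro l l' hne
    refine Set.disjoint_left.2 fun x hx hx' => hne (funext fun i => ?_)
    rw [← hfloor l x hx i, hfloor l' x hx' i]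
  have hunion : ⋃ l, s l = Set.univ := by
    refine Set.eq_univ_of_forall fun x => Set.mem_iUnion.2 ⟨fun i => ⌊x i⌋, fun i => ?_⟩
    simp only [PiLp.sub_apply, intPoint]
    exact ⟨Int.fract_nonneg _, Int.fract_lt_one _⟩
  have h := hasSum_integral_iUnion hs hdisj hF.integrableOn
  rw [hunion, setIntegral_univ] at h
  refine h.congr_fun fun l => ?_
  have h1 := (measurePreserving_sub_right volume (intPoint l)).setIntegral_preimage_emb
    (MeasurableEquiv.subRight (intPoint l)).measurableEmbedding
    (fun x => F (x + intPoint l)) (unitCube n)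
  simp only [sub_add_cancel] at h1
  exact h1.symm

theorem latticeCount_real_ball {n : ℕ} (x : EuclideanSpace ℝ (Fin n)) (R : ℝ) :
    (latticeCount x).real (Metric.ball 0 R)
      = ∑' l : Fin n → ℤ, (Metric.ball 0 R).indicator (fun _ => (1 : ℝ)) (x + intPoint l) := by
  rw [measureReal_def, latticeCount, Measure.sum_apply _ Metric.isOpen_ball.measurableSet,
    ENNReal.tsum_toReal_eq fun l => measure_ne_top _ _]
  refine tsum_congr fun l => ?_
  rw [Measure.dirac_apply' _ Metric.isOpen_ball.measurableSet]
  by_cases h : x + intPoint l ∈ Metric.ball 0 R <;> simp [h]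

/-- Unfolding: the Fourier coefficients of the lattice point count. -/
theorem setIntegral_unitCube_cubeChar_mul_latticeCount {n : ℕ} (k : Fin n → ℤ) (R : ℝ) :
    ∫ x in unitCube n, cubeChar k x * ((latticeCount x).real (Metric.ball 0 R) : ℂ)
      = ballFourier n R (intPoint k) := by
  let F : EuclideanSpace ℝ (Fin n) → ℂ := (Metric.ball 0 R).indicator (cubeChar k)
  have hball : MeasurableSet (Metric.ball (0 : EuclideanSpace ℝ (Fin n)) R) :=
    Metric.isOpen_ball.measurableSet
  have hF : Integrable F := by
    refine (integrable_indicator_iff hball).2 (Measure.integrableOn_of_bounded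
      measure_ball_lt_top.ne (continuous_cubeChar k).aestronglyMeasurable (M := 1)
      (ae_of_all _ fun x => (norm_cubeChar k x).le))
  have h1 := hasSum_setIntegral_unitCube_add F hF
  -- Unfolding `‖F‖` as well justifies exchanging sum and integral.
  have h2 := hasSum_setIntegral_unitCube_add (fun x => ‖F x‖) hF.norm
  have h3 := hasSum_integral_of_summable_integral_norm
    (F := fun (l : Fin n → ℤ) x => F (x + intPoint l)) (μ := volume.restrict (unitCube n))
    (fun l => (hF.comp_add_right _).integrableOn) h2.summable
  have h4 := h3.unique h1
  rw [integral_indicator hball] at h4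
  rw [ballFourier]
  refine Eq.trans (integral_congr_ae (ae_of_all _ fun x => ?_)) h4
  simp only [latticeCount_real_ball, Complex.ofReal_tsum]
  rw [← tsum_mul_left]
  refine tsum_congr fun l => ?_
  by_cases h : x + intPoint l ∈ Metric.ball 0 R
  · simp [F, h, cubeChar_add_intPoint]
  · simp [F, h]

theorem measurable_countStatistic {n : ℕ} {B : Set (EuclideanSpace ℝ (Fin n))}
    (hB : MeasurableSet B) : Measurable (countStatistic B) :=
  ((Measure.measurable_coe hB).comp measurable_subtype_coe).ennreal_toReal

/-- Boundedness of the count supplies the square-integrability needed for Parseval and for a finite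
variance. -/
theorem exists_latticeCount_real_ball_le (n : ℕ) (R : ℝ) :
    ∃ C, ∀ x : EuclideanSpace ℝ (Fin n), (∀ i, x i ∈ Set.Icc (0 : ℝ) 1) →
      (latticeCount x).real (Metric.ball 0 R) ≤ C := by
  let S : Finset (Fin n → ℤ) := Fintype.piFinset fun _ => Finset.Icc (-(⌈R⌉ + 1)) (⌈R⌉ + 1)
  refine ⟨S.card, fun x hx => ?_⟩
  rw [latticeCount_real_ball, tsum_eq_sum (s := S)]
  · rw [Finset.card_eq_sum_ones, Nat.cast_sum]
    refine Finset.sum_le_sum fun l _ => ?_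
    by_cases h : x + intPoint l ∈ Metric.ball 0 R <;> simp [h]
  · intro l hl
    refine Set.indicator_of_notMem (fun h => hl ?_) _
    refine Fintype.mem_piFinset.2 fun i => ?_
    have h1 : |x i + l i| < R := by
      refine lt_of_le_of_lt ?_ (mem_ball_zero_iff.1 h)
      simpa [intPoint] using PiLp.norm_apply_le (x + intPoint l) i
    have h2 := abs_lt.1 h1
    have h3 := hx i
    have h4 := Int.le_ceil R
    have h5 : (l i : ℝ) ≤ ((⌈R⌉ + 1 : ℤ) : ℝ) := by push_cast; linarith [h3.1, h2.2]
    have h6 : ((-(⌈R⌉ + 1) : ℤ) : ℝ) ≤ l i := by push_cast; linarith [h3.2, h2.1]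
    exact Finset.mem_Icc.2 ⟨by exact_mod_cast h6, by exact_mod_cast h5⟩

/-! ### The variance as a lattice sum, and its limit -/

open Classical in
/-- The number variance of the shifted lattice as a sum over the nonzero frequencies. -/
theorem numberVariance_randomLattice_eq_tsum (n : ℕ) (R : ℝ) :
    numberVariance (randomLattice n) R = ENNReal.ofReal
      (∑' k : Fin n → ℤ, if k = 0 then 0 else ‖ballFourier n R (intPoint k)‖ ^ 2) := by
  have hball : MeasurableSet (Metric.ball (0 : EuclideanSpace ℝ (Fin n)) R) :=
    Metric.isOpen_ball.measurableSet
  let N : EuclideanSpace ℝ (Fin n) → ℝ := fun x => (latticeCount x).real (Metric.ball 0 R)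
  have hprob : IsProbabilityMeasure ((volume : Measure (EuclideanSpace ℝ (Fin n))).restrict
    (unitCube n)) := ⟨by rw [Measure.restrict_apply_univ, volume_unitCube]⟩
  have hX := measurable_countStatistic hball
  have hN : Measurable N := hX.comp measurable_shiftedLattice
  obtain ⟨C, hC⟩ := exists_latticeCount_real_ball_le n R
  have hC' : ∀ x, (∀ i, x i ∈ Set.Icc (0 : ℝ) 1) → ‖N x‖ ≤ C := fun x hx => by
    rw [Real.norm_of_nonneg measureReal_nonneg]
    exact hC x hx
  have hNmem : MemLp N 2 (volume.restrict (unitCube n)) := by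
    refine MemLp.of_bound hN.aestronglyMeasurable C ?_
    filter_upwards [ae_restrict_mem (measurableSet_unitCube n)] with x hx
    exact hC' x fun i => ⟨(hx i).1, (hx i).2.le⟩
  have hmem : MemLp (countStatistic (Metric.ball (0 : EuclideanSpace ℝ (Fin n)) R)) 2
      (randomLattice n) :=
    (memLp_map_measure_iff hX.aestronglyMeasurable measurable_shiftedLattice.aemeasurable).2 hNmem
  have hvar : ProbabilityTheory.variance
      (countStatistic (Metric.ball (0 : EuclideanSpace ℝ (Fin n)) R)) (randomLattice n)
      = (∫ x in unitCube n, N x ^ 2) - (∫ x in unitCube n, N x) ^ 2 := by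
    rw [randomLattice, ProbabilityTheory.variance_map hX.aemeasurable
      measurable_shiftedLattice.aemeasurable]
    exact ProbabilityTheory.variance_eq_sub hNmem
  have hsum := hasSum_sq_norm_integral_cubeChar (fun x => (N x : ℂ))
    (Complex.measurable_ofReal.comp hN) C
    (fun x hx => by rw [Complex.norm_real]; exact hC' x hx)
  simp only [N, setIntegral_unitCube_cubeChar_mul_latticeCount, Complex.norm_real,
    Real.norm_eq_abs, sq_abs] at hsum
  -- The zero frequency is the squared mean, exactly what the variance subtracts from the second
  -- moment.
  have hzero : ‖ballFourier n R (intPoint 0)‖ ^ 2 = (∫ x in unitCube n, N x) ^ 2 := by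
    rw [← setIntegral_unitCube_cubeChar_mul_latticeCount]
    have : ∀ x, cubeChar (0 : Fin n → ℤ) x = 1 := fun x => by
      have h0 : intPoint (0 : Fin n → ℤ) = 0 := by ext i; simp [intPoint]
      simp [cubeChar, h0]
    simp only [this, one_mul, integral_complex_ofReal, Complex.norm_real, Real.norm_eq_abs,
      sq_abs, N]
  have h := hasSum_ite_sub_hasSum hsum 0
  rw [hzero] at h
  rw [numberVariance, ← ProbabilityTheory.ofReal_variance hmem, hvar, h.tsum_eq]

/-- The summands dominating the number variance, up to the factor `R ^ (2 * p)`. -/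
noncomputable def varianceTerm (p : ℕ) (R : ℝ) (k : Fin (2 * p + 1) → ℤ) : ℝ :=
  (|Real.sin (R * (2 * Real.pi * ‖intPoint k‖))| + 1 / R) ^ 2 * ‖intPoint k‖⁻¹ ^ (2 * p + 2)

theorem varianceTerm_nonneg (p : ℕ) (R : ℝ) (k : Fin (2 * p + 1) → ℤ) : 0 ≤ varianceTerm p R k := by
  unfold varianceTerm
  positivity

/-- A majorant independent of `R`, for dominated convergence. At `k = 0` both sides are zero, since
`0⁻¹ = 0`. -/
theorem varianceTerm_le (p : ℕ) {R : ℝ} (hR : 1 ≤ R) (k : Fin (2 * p + 1) → ℤ) :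
    varianceTerm p R k ≤ 2 ^ 2 * ‖intPoint k‖⁻¹ ^ (2 * p + 2) := by
  have h1 := Real.abs_sin_le_one (R * (2 * Real.pi * ‖intPoint k‖))
  have h2 : 1 / R ≤ 1 := (div_le_one (by linarith)).2 hR
  have h3 : 0 ≤ 1 / R := by positivity
  unfold varianceTerm
  gcongr
  linarith

theorem summable_varianceTerm (p : ℕ) {R : ℝ} (hR : 1 ≤ R) : Summable (varianceTerm p R) :=
  Summable.of_nonneg_of_le (varianceTerm_nonneg p R) (varianceTerm_le p hR)
    ((summable_inv_norm_intPoint_pow (2 * p + 1) (2 * p + 2) (by omega)).mul_left _)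

open Classical in
theorem exists_numberVariance_le (p : ℕ) (hp : Even p) :
    ∃ C, 0 ≤ C ∧ ∀ R : ℝ, 1 ≤ R → numberVariance (randomLattice (2 * p + 1)) R
      ≤ ENNReal.ofReal (C * R ^ (2 * p) * ∑' k, varianceTerm p R k) := by
  obtain ⟨C, hC, h⟩ := exists_norm_ballFourier_sq_le p hp
  refine ⟨C, hC, fun R hR => ?_⟩
  have hR0 : 0 < R := by linarith
  rw [numberVariance_randomLattice_eq_tsum, ← tsum_mul_left]
  refine ENNReal.ofReal_le_ofReal ?_
  have hs := (summable_varianceTerm p hR).mul_left (C * R ^ (2 * p))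
  have hle : ∀ k : Fin (2 * p + 1) → ℤ,
      (if k = 0 then 0 else ‖ballFourier (2 * p + 1) R (intPoint k)‖ ^ 2)
        ≤ C * R ^ (2 * p) * varianceTerm p R k := by
    intro k
    split_ifs with hk
    · exact mul_nonneg (by positivity) (varianceTerm_nonneg p R k)
    · have h1 := norm_intPoint_ge_one hk
      refine (h hR0 (norm_pos_iff.1 (by linarith))).trans ?_
      unfold varianceTerm
      gcongr
      -- Since `‖k‖ ≥ 1`, the error `1 / (R‖k‖)` is at most `1 / R`.
      exact le_mul_of_one_le_right hR0.le h1
  refine Summable.tsum_le_tsum hle (Summable.of_nonneg_of_le (fun k => ?_) hle hs) hs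
  split_ifs
  · exact le_rfl
  · positivity

theorem liminf_numberVariance_div_sphere (p : ℕ) (hp : Even p) :
    liminf (fun R : ℝ => numberVariance (randomLattice (2 * p + 1)) R /
      Measure.euclideanHausdorffMeasure (2 * p)
        (Metric.sphere (0 : EuclideanSpace ℝ (Fin (2 * p + 1))) R)) atTop = 0 := by
  obtain ⟨C, hC, hvar⟩ := exists_numberVariance_le p hp
  obtain ⟨U, hU, hsin⟩ := exists_ultrafilter_tendsto_sin
    fun k : Fin (2 * p + 1) → ℤ => 2 * Real.pi * ‖intPoint k‖
  have hω := unitBallVolume_pos (2 * p)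
  have hcast : Tendsto (fun j : ℕ => (j : ℝ)) U atTop := tendsto_natCast_atTop_atTop.mono_left hU
  have hone : ∀ᶠ j : ℕ in U, (1 : ℝ) ≤ j := hcast.eventually_ge_atTop 1
  have hterm : ∀ k, Tendsto (fun j : ℕ => varianceTerm p j k) U (nhds 0) := by
    intro k
    have h1 : Tendsto (fun j : ℕ => 1 / (j : ℝ)) U (nhds 0) := by
      simpa [Function.comp_def] using tendsto_inv_atTop_zero.comp hcast
    have h2 := (((hsin k).abs.add h1).pow 2).mul_const (‖intPoint k‖⁻¹ ^ (2 * p + 2))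
    simpa [varianceTerm] using h2
  have hsum : Tendsto (fun j : ℕ => ∑' k, varianceTerm p j k) U (nhds 0) := by
    have := tendsto_tsum_of_dominated_convergence
      ((summable_inv_norm_intPoint_pow (2 * p + 1) (2 * p + 2) (by omega)).mul_left (2 ^ 2))
      hterm (by
        filter_upwards [hone] with j hj k
        rw [Real.norm_of_nonneg (varianceTerm_nonneg p j k)]
        exact varianceTerm_le p hj k)
    simpa using this
  have hlim : Tendsto (fun j : ℕ =>
      ENNReal.ofReal (C / unitBallVolume (2 * p) * ∑' k, varianceTerm p j k)) U (nhds 0) := by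
    simpa using ENNReal.tendsto_ofReal (hsum.const_mul (C / unitBallVolume (2 * p)))
  have hratio : Tendsto (fun j : ℕ => numberVariance (randomLattice (2 * p + 1)) j /
      Measure.euclideanHausdorffMeasure (2 * p)
        (Metric.sphere (0 : EuclideanSpace ℝ (Fin (2 * p + 1))) (j : ℝ))) U (nhds 0) := by
    refine tendsto_of_tendsto_of_tendsto_of_le_of_le' tendsto_const_nhds hlim
      (Eventually.of_forall fun _ => zero_le) ?_
    filter_upwards [hone] with j hj
    have hj0 : (0 : ℝ) < j := by linarith
    refine (ENNReal.div_le_div (hvar j hj)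
      (volume_ball_le_euclideanHausdorffMeasure_sphere (2 * p) j)).trans ?_
    rw [volume_ball_eq _ hj0, ← ENNReal.ofReal_div_of_pos (by positivity)]
    refine ENNReal.ofReal_le_ofReal (le_of_eq ?_)
    field_simp
  -- The image of `U` is finer than `atTop` on `ℝ`, so the liminf along `atTop` is at most the limit
  -- along `U`.
  have hle : Filter.map (fun j : ℕ => (j : ℝ)) U ≤ atTop := hcast
  refine le_antisymm ((liminf_le_liminf_of_le hle).trans (le_of_eq ?_)) zero_le
  exact Tendsto.liminf_eq (tendsto_map'_iff.2 hratio)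

theorem mainTheorem6 (m : ℕ) :
    liminf (fun R : ℝ => numberVariance (randomLattice (4 * m + 1)) R /
      Measure.euclideanHausdorffMeasure (4 * m)
        (Metric.sphere (0 : EuclideanSpace ℝ (Fin (4 * m + 1))) R)) atTop = 0 := by
  -- The dimension occurs in types, so `4 * m = 2 * (2 * m)` is substituted through a variable.
  have h : ∀ q, q = 2 * (2 * m) →
      liminf (fun R : ℝ => numberVariance (randomLattice (q + 1)) R /
        Measure.euclideanHausdorffMeasure q
          (Metric.sphere (0 : EuclideanSpace ℝ (Fin (q + 1))) R)) atTop = 0 := by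
    rintro _ rfl
    exact liminf_numberVariance_div_sphere (2 * m) (even_two_mul m)
  exact h (4 * m) (by ring)
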